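/- Let $R>0$, let $\mathbb B_R=\{x\in\mathbb R^3:|x|<R\}$, $\mathbb S_r=\{x\in\mathbb R^3:|x|=r\}$, and let $\omega_r$ be the surface area measure of $\mathbb S_r$. For a distribution $D$ on $\mathbb R^3$ supported in $\overline{\mathbb B_R}$ let $$p_D(x)=D\Big(-\frac1{4\pi|x-\cdot|}\Big),\qquad x\in\mathbb R^3\setminus\overline{\mathbb B_R},$$ be its potential, where the kernel is multiplied by a function in $C_c^\infty(\mathbb R^3)$ that is $1$ near $\overline{\mathbb B_R}$ and $0$ near $x$ (the value does not depend on this function). A balayage of $D$ onto $\mathbb S_R$ is a distribution $\hat D$ on the manifold $\mathbb S_R$ (a continuous linear form on $C^\infty(\mathbb S_R)$) such that $p_{\hat D}(x)=p_D(x)$ for all $x\in\mathbb R^3\setminus\overline{\mathbb B_R}$, where $p_{\hat D}(x)$ is $\hat D$ applied to the restriction of $-1/(4\pi|x-\cdot|)$ to $\mathbb S_R$. As a distribution on $\mathbb R^3$, $\hat D$ acts by $\varphi\mapsto\hat D(\varphi|_{\mathbb S_R})$. **Lemma 3.2.** Let $\mathbf M\in L^2(\mathbb B_R,\mathbb R^3)$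 satisfy the Hardy condition $$\operatorname*{ess\,sup}_{0\le r<R}\int_{\mathbb S_r}|\mathbf M(y)|^2\,d\omega_r(y)<\infty ,$$ and let $D=\nabla\cdot\mathbf M$ be the distributional divergence on $\mathbb R^3$ of $\mathbf M$ extended by $0$ outside $\mathbb B_R$. Then $D$ is supported in $\overline{\mathbb B_R}$ and there exists $\mathbf m\in L^2(\mathbb S_R,\mathbb R^3)$ such that $\hat D=\nabla\cdot(\mathbf m\otimes\delta_{\mathbb S_R})$ is the balayage of $D$ onto $\mathbb S_R$. Here $\mathbf m\otimes\delta_{\mathbb S_R}$ is the $\mathbb R^3$-valued distribution $\varphi\mapsto\int_{\mathbb S_R}\varphi\,\mathbf m\,d\omega_R$ on $\mathbb R^3$; that is, $\hat D(\varphi|_{\mathbb S_R})=-\int_{\mathbb S_R}\mathbf m\cdot\nabla\varphi\,d\omega_R$ for all $\varphi\in C_c^\infty(\mathbb R^3)$. -/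

import Mathlib

open MeasureTheory Set Filter Topology
open scoped Distributions ContDiff

noncomputable section

namespace Balayage

/-- Euclidean space `ℝ³`. -/
abbrev E3 : Type := EuclideanSpace ℝ (Fin 3)

/-- The surface area measure `ω_r` of the sphere `S_r = {y : |y| = r}`, as a measure on `ℝ³`:
the image under `y ↦ r y` of the surface area measure of the unit sphere, times `r²`. -/
def sphereMeasure (r : ℝ) : Measure E3 :=
  ENNReal.ofReal (r ^ 2) •
    ((volume : Measure E3).toSphere).map (fun y : Metric.sphere (0 : E3) 1 => r • (y : E3))

/-- The Hardy condition: the essential supremum over `0 ≤ r < R` of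
`∫_{S_r} |M|² dω_r` is finite. -/
def HardyCondition (R : ℝ) (M : E3 → E3) : Prop :=
  essSup (fun r : ℝ => ∫⁻ y, ‖M y‖ₑ ^ 2 ∂(sphereMeasure r))
    ((volume : Measure ℝ).restrict (Ico 0 R)) < ⊤

/-! ### Distributions on `ℝ³` -/

/-- The `ℝ³`-valued distribution `M μ`, that is `φ ↦ ∫ φ M dμ`
(for `M` locally `μ`-integrable). -/
def fieldDistribution (μ : Measure E3) (M : E3 → E3) : 𝓓'((⊤ : TopologicalSpace.Opens E3), E3) :=
  (TestFunction.integralAgainstBilinCLM (ContinuousLinearMap.lsmul ℝ ℝ) μ M :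
    𝓓((⊤ : TopologicalSpace.Opens E3), ℝ) →L[ℝ] E3)

open LineDeriv in
/-- The distributional divergence `∇ · T = ∑ⱼ ∂ⱼ Tⱼ` of an `ℝ³`-valued distribution. -/
def divergence (T : 𝓓'((⊤ : TopologicalSpace.Opens E3), E3)) :
    𝓓'((⊤ : TopologicalSpace.Opens E3), ℝ) :=
  ∑ j : Fin 3, ∂_{EuclideanSpace.single j (1 : ℝ)}
    (Distribution.mapCLM (EuclideanSpace.proj j : E3 →L[ℝ] ℝ) T :
      𝓓'((⊤ : TopologicalSpace.Opens E3), ℝ))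

/-! ### Potentials of distributions -/

/-- The kernel `y ↦ -1 / (4π |x - y|)`. -/
def newtonKernel (x y : E3) : ℝ := -(1 / (4 * Real.pi)) * (1 / ‖x - y‖)

theorem contDiffAt_newtonKernel {x y : E3} (h : y ≠ x) :
    ContDiffAt ℝ ∞ (newtonKernel x) y := by
  have h0 : x - y ≠ 0 := sub_ne_zero.2 h.symm
  unfold newtonKernel
  refine contDiffAt_const.mul (contDiffAt_const.div ?_ (norm_ne_zero_iff.2 h0))
  exact (contDiffAt_const.sub contDiffAt_id).norm ℝ h0

/-- The test function `y ↦ -φ(y) / (4π |x - y|)`, for a test function `φ` that vanishes near `x`. -/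
def truncKernel (x : E3) (φ : 𝓓((⊤ : TopologicalSpace.Opens E3), ℝ))
    (hφ : ∀ᶠ y in 𝓝 x, φ y = 0) : 𝓓((⊤ : TopologicalSpace.Opens E3), ℝ) where
  toFun y := newtonKernel x y * φ y
  contDiff' := by
    rw [contDiff_iff_contDiffAt]
    intro y
    by_cases h : y = x
    · subst h
      refine (contDiffAt_const (c := (0 : ℝ))).congr_of_eventuallyEq ?_
      filter_upwards [hφ] with z hz
      simp [hz]
    · exact (contDiffAt_newtonKernel h).mul φ.contDiff.contDiffAt
  hasCompactSupport' := φ.hasCompactSupport.mul_left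
  tsupport_subset' := by simp

/-- A smooth compactly supported cutoff that is `1` in a neighbourhood of the closed ball of
radius `R` and `0` in a neighbourhood of a point `x` outside of it. -/
def cutoff {R : ℝ} (hR : 0 < R) {x : E3} (hx : R < ‖x‖) :
    𝓓((⊤ : TopologicalSpace.Opens E3), ℝ) :=
  let b : ContDiffBump (0 : E3) :=
    ⟨(2 * R + ‖x‖) / 3, (R + 2 * ‖x‖) / 3, by linarith, by linarith⟩
  { toFun := b
    contDiff' := b.contDiff
    hasCompactSupport' := b.hasCompactSupport
    tsupport_subset' := by simp }

theorem cutoff_eventually_one {R : ℝ} (hR : 0 < R) {x : E3} (hx : R < ‖x‖) :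
    ∀ᶠ y in 𝓝ˢ (Metric.closedBall (0 : E3) R), cutoff hR hx y = 1 := by
  have ho : IsOpen (Metric.ball (0 : E3) ((2 * R + ‖x‖) / 3)) := Metric.isOpen_ball
  have hs : Metric.closedBall (0 : E3) R ⊆ Metric.ball 0 ((2 * R + ‖x‖) / 3) :=
    Metric.closedBall_subset_ball (by linarith)
  filter_upwards [ho.mem_nhdsSet.2 hs] with y hy
  exact ContDiffBump.one_of_mem_closedBall _ (Metric.ball_subset_closedBall hy)

theorem cutoff_eventually_zero {R : ℝ} (hR : 0 < R) {x : E3} (hx : R < ‖x‖) :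
    ∀ᶠ y in 𝓝 x, cutoff hR hx y = 0 := by
  have ho : IsOpen {y : E3 | (R + 2 * ‖x‖) / 3 < ‖y‖} := isOpen_lt continuous_const continuous_norm
  have hm : x ∈ {y : E3 | (R + 2 * ‖x‖) / 3 < ‖y‖} := by
    simp only [mem_ofPred_eq]; linarith
  filter_upwards [ho.mem_nhds hm] with y hy
  refine ContDiffBump.zero_of_le_dist _ ?_
  simpa [dist_zero_right] using (show (R + 2 * ‖x‖) / 3 < ‖y‖ from hy).le

/-- The potential `p_D(x) = D(-1 / (4π |x - ·|))`, `|x| > R`, of a distribution `D` supported in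
the closed ball of radius `R`. It is obtained by applying `D` to the kernel cut off outside a
neighbourhood of the ball; see `apply_truncKernel_eq_potential` for the independence of the
cutoff. -/
def potential (D : 𝓓'((⊤ : TopologicalSpace.Opens E3), ℝ)) {R : ℝ} (hR : 0 < R) (x : E3)
    (hx : R < ‖x‖) : ℝ :=
  D (truncKernel x (cutoff hR hx) (cutoff_eventually_zero hR hx))

/-- The distribution `D` is supported in the closed ball of radius `R`: it vanishes on all test
functions supported in the complement of that ball. -/
def SupportedInBall (D : 𝓓'((⊤ : TopologicalSpace.Opens E3), ℝ)) (R : ℝ) : Prop :=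
  Distribution.IsVanishingOn D (Metric.closedBall (0 : E3) R)ᶜ

theorem apply_truncKernel_eq_potential (D : 𝓓'((⊤ : TopologicalSpace.Opens E3), ℝ)) {R : ℝ}
    (hD : SupportedInBall D R) (hR : 0 < R) (x : E3) (hx : R < ‖x‖)
    (φ : 𝓓((⊤ : TopologicalSpace.Opens E3), ℝ))
    (h1 : ∀ᶠ y in 𝓝ˢ (Metric.closedBall (0 : E3) R), φ y = 1) (h0 : ∀ᶠ y in 𝓝 x, φ y = 0) :
    D (truncKernel x φ h0) = potential D hR x hx := by
  rw [potential, ← sub_eq_zero, ← map_sub]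
  apply hD
  intro y hy hyR
  have h1' := (eventually_nhdsSet_iff_forall.1 h1) y hyR
  have h2' := (eventually_nhdsSet_iff_forall.1 (cutoff_eventually_one hR hx)) y hyR
  refine notMem_tsupport_iff_eventuallyEq.2 ?_ hy
  filter_upwards [h1', h2'] with z hz1 hz2
  change newtonKernel x z * φ z - newtonKernel x z * cutoff hR hx z = 0
  rw [hz1, hz2, sub_self]

/-! ### Distributions on the sphere -/

/-- The radial extension `x ↦ f (R x / |x|)` of a function `f` on the sphere `S_R`
(with the irrelevant value `0` at the origin). -/
def radialExt (R : ℝ) (f : Metric.sphere (0 : E3) R → ℝ) (x : E3) : ℝ :=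
  Function.extend (Subtype.val : Metric.sphere (0 : E3) R → E3) f 0 ((R / ‖x‖) • x)

theorem radialExt_apply {R : ℝ} (hR : 0 < R) (f : Metric.sphere (0 : E3) R → ℝ) {x : E3}
    (hx : x ≠ 0) :
    radialExt R f x = f ⟨(R / ‖x‖) • x, by
      have : ‖x‖ ≠ 0 := norm_ne_zero_iff.2 hx
      simp [norm_smul, abs_of_pos hR, this]⟩ :=
  Subtype.val_injective.extend_apply f 0 ⟨(R / ‖x‖) • x, _⟩

theorem radialExt_zero (R : ℝ) : radialExt R 0 = 0 := by
  funext x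
  by_cases h : ∃ a : Metric.sphere (0 : E3) R, a.1 = (R / ‖x‖) • x <;>
    simp [radialExt, Function.extend, h]

theorem radialExt_add (R : ℝ) (f g : Metric.sphere (0 : E3) R → ℝ) :
    radialExt R (f + g) = radialExt R f + radialExt R g := by
  funext x
  by_cases h : ∃ a : Metric.sphere (0 : E3) R, a.1 = (R / ‖x‖) • x <;>
    simp [radialExt, Function.extend, h]

theorem radialExt_smul (R c : ℝ) (f : Metric.sphere (0 : E3) R → ℝ) :
    radialExt R (c • f) = c • radialExt R f := by
  funext x
  by_cases h : ∃ a : Metric.sphere (0 : E3) R, a.1 = (R / ‖x‖) • x <;>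
    simp [radialExt, Function.extend, h]

/-- The space `C^∞(S_R)`: functions on the sphere whose radial extension is smooth on
`ℝ³ ∖ {0}`. -/
def SmoothSphere (R : ℝ) : Submodule ℝ (Metric.sphere (0 : E3) R → ℝ) where
  carrier := {f | ContDiffOn ℝ ∞ (radialExt R f) {0}ᶜ}
  zero_mem' := by
    simp only [mem_ofPred_eq, radialExt_zero]
    exact contDiffOn_const
  add_mem' {f g} hf hg := by
    simp only [mem_ofPred_eq, radialExt_add] at *
    exact hf.add hg
  smul_mem' c f hf := by
    simp only [mem_ofPred_eq, radialExt_smul] at *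
    exact hf.const_smul c

/-- The restriction to `S_R` of a function that is smooth near every point of `S_R`. -/
def SmoothSphere.restrict {R : ℝ} (hR : 0 < R) (F : E3 → ℝ)
    (hF : ∀ y ∈ Metric.sphere (0 : E3) R, ContDiffAt ℝ ∞ F y) : SmoothSphere R :=
  ⟨fun y => F y, by
    change ContDiffOn ℝ ∞ (radialExt R fun y => F y) {0}ᶜ
    have h : ContDiffOn ℝ ∞ (fun x : E3 => F ((R / ‖x‖) • x)) {0}ᶜ := by
      intro x hx
      have hx' : x ≠ 0 := hx
      have hn : ‖x‖ ≠ 0 := norm_ne_zero_iff.2 hx'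
      refine ContDiffAt.contDiffWithinAt ?_
      have hin : ContDiffAt ℝ ∞ (fun x : E3 => (R / ‖x‖) • x) x :=
        (contDiffAt_const.div (contDiffAt_id.norm ℝ hx') hn).smul contDiffAt_id
      exact ContDiffAt.comp x (hF _ (by simp [norm_smul, abs_of_pos hR, hn])) hin
    exact h.congr fun x hx => radialExt_apply hR _ hx⟩

/-- A distribution on the sphere `S_R`: a linear form on `C^∞(S_R)` that is continuous, that is,
bounded by the maximum over `S_R` of finitely many derivatives (of the radial extension). -/
structure SphereDistribution (R : ℝ) where
  toLinearMap : SmoothSphere R →ₗ[ℝ] ℝ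
  continuous' : ∃ (N : ℕ) (C : ℝ), ∀ (f : SmoothSphere R) (A : ℝ),
    (∀ k ≤ N, ∀ y ∈ Metric.sphere (0 : E3) R, ‖iteratedFDeriv ℝ k (radialExt R f) y‖ ≤ A) →
      |toLinearMap f| ≤ C * A

/-- The tensor product `T ⊗ δ_{S_R}` of a distribution `T` on `S_R` with the measure `δ_{S_R}`,
as a function of the test function: `φ ↦ T(φ|_{S_R})`. -/
def SphereDistribution.tensorDelta {R : ℝ} (hR : 0 < R) (T : SphereDistribution R)
    (φ : 𝓓((⊤ : TopologicalSpace.Opens E3), ℝ)) : ℝ :=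
  T.toLinearMap (SmoothSphere.restrict hR φ fun _ _ => φ.contDiff.contDiffAt)

/-- The potential of a distribution `T` on `S_R` at a point `x` with `|x| > R`: `T` is applied to
the restriction to `S_R` of the kernel `-1 / (4π |x - ·|)`. -/
def SphereDistribution.potential {R : ℝ} (hR : 0 < R) (T : SphereDistribution R) (x : E3)
    (hx : R < ‖x‖) : ℝ :=
  T.toLinearMap (SmoothSphere.restrict hR (newtonKernel x) fun y hy =>
    contDiffAt_newtonKernel (by
      rintro rfl
      rw [mem_sphere_zero_iff_norm] at hy
      exact hx.ne' hy))

/-- `T` is the balayage onto `S_R` of the distribution `D`, which is supported in the closed ball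
of radius `R`: the distribution on `S_R` whose potential coincides with that of `D` outside of the
closed ball. -/
def IsBalayage {R : ℝ} (hR : 0 < R) (D : 𝓓'((⊤ : TopologicalSpace.Opens E3), ℝ))
    (T : SphereDistribution R) : Prop :=
  SupportedInBall D R ∧ ∀ (x : E3) (hx : R < ‖x‖), T.potential hR x hx = potential D hR x hx

end Balayage

end

open Balayage

/-!
# Balayage of divergences onto a sphere

The harmonic extension to the ball `B_R` of the kernel `N_x = -1 / (4π |x - ·|)` restricted to `S_R`
is `N_x` itself when `|x| > R`. So balayage asks for a field `m` on `S_R` with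
`∫_{S_R} m · ∇u = ∫_{B_R} M · ∇u` for all `u = N_x`, and `m` is sought so that this holds for every
`u` that is harmonic on a neighbourhood of the closed ball (`exists_tangential_field`). If `m` is
moreover tangential, then `∫_{S_R} m · ∇φ` depends only on the restriction of `φ` to `S_R`, so that
`-∫_{S_R} m · ∇φ` is a distribution on the sphere (`sphereDivergence`, `sphereDivergence_restrict`).

To find `m`, the right hand side is bounded by the Cauchy-Schwarz inequality on the ball and by the
inequality `R ∫_{B_R} |∇u|² ≤ ∫_{S_R} |y × ∇u|² dω_R` for harmonic `u`
(`integral_norm_fderiv_sq_le`). The functional `u ↦ ∫_{B_R} M · ∇u` therefore factors boundedly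
through `u ↦ (y × ∇u)|_{S_R} ∈ L²(S_R, ℝ³)`, and the Hahn-Banach and Riesz theorems represent it by
some `w ∈ L²(S_R, ℝ³)`, as `∫_{S_R} w · (y × ∇u)`. Then `m(y) = w(y) × y` does what is wanted.

The inequality comes from Rellich's identity. Let `Lₖ`, `k = 1, 2, 3`, be the derivatives along the
rotation fields and `E = x · ∇`. For harmonic `u`, since `∑ Lₖ² u = -(E² u + E u)` and `E`
commutes with `Lₖ`, the density `g = ∑ (Lₖ u)² - (E u)²` satisfies
`g + E g = |x|² |∇u|² + 2 ∑ Lₖ (Lₖ u · E u)` (`rellichDensity_add_fderiv`). The last sum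
integrates to zero over every sphere by rotation invariance (`sphereIntegral_fderiv_skew`), and the spherical
integral of `g + E g` at radius `r` is the derivative of `r ∫ g(rσ) dσ`
(`hasDerivAt_mul_sphereIntegral`). Integration over `0 < r < R` in polar coordinates gives
`∫_{B_R} |∇u|² = R ∫ g(Rσ) dσ`, and dropping the term `-(E u)²` gives the inequality.
-/

open MeasureTheory Set Filter Topology
open scoped Distributions ContDiff

noncomputable section

namespace Balayage

/-! ### Distributional divergences -/

theorem fieldDistribution_apply {μ : Measure E3} {m : E3 → E3} (hm : LocallyIntegrable m μ)
    (φ : 𝓓((⊤ : TopologicalSpace.Opens E3), ℝ)) :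
    fieldDistribution μ m φ = ∫ y, φ y • m y ∂μ :=
  TestFunction.integralAgainstBilinCLM_eq_integral (hm.locallyIntegrableOn _)

open LineDeriv in
theorem testFunction_lineDeriv_apply (φ : 𝓓((⊤ : TopologicalSpace.Opens E3), ℝ)) (v y : E3) :
    (∂_{v} φ : 𝓓((⊤ : TopologicalSpace.Opens E3), ℝ)) y = fderiv ℝ φ y v := by
  rw [TestFunction.lineDerivOp_eq_lineDerivCLM (𝕜 := ℝ),
    TestFunction.lineDerivCLM_apply_of_le (by simp)]
  exact (φ.contDiff.differentiable (by simp)).differentiableAt.lineDeriv_eq_fderiv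

theorem apply_eq_sum (L : E3 →L[ℝ] ℝ) (v : E3) :
    L v = ∑ j, v j * L (EuclideanSpace.single j 1) := by
  conv_lhs => rw [← (EuclideanSpace.basisFun (Fin 3) ℝ).sum_repr v]
  simp

theorem apply_eq_sum_three (L : E3 →L[ℝ] ℝ) (v : E3) :
    L v = v 0 * L (EuclideanSpace.single 0 1) + v 1 * L (EuclideanSpace.single 1 1)
      + v 2 * L (EuclideanSpace.single 2 1) := by
  rw [apply_eq_sum, Fin.sum_univ_three]

open LineDeriv in
theorem divergence_fieldDistribution_apply {μ : Measure E3} {m : E3 → E3}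
    (hm : LocallyIntegrable m μ) (φ : 𝓓((⊤ : TopologicalSpace.Opens E3), ℝ)) :
    divergence (fieldDistribution μ m) φ = -∫ y, fderiv ℝ φ y (m y) ∂μ := by
  have hint : ∀ j : Fin 3, Integrable
      (fun y => fderiv ℝ φ y (EuclideanSpace.single j 1) • m y) μ := by
    intro j
    refine hm.integrable_smul_left_of_hasCompactSupport ?_ ?_
    · exact (φ.contDiff.continuous_fderiv (by simp)).clm_apply continuous_const
    · exact (φ.hasCompactSupport.fderiv (𝕜 := ℝ)).comp_left
        (g := fun L : E3 →L[ℝ] ℝ => L (EuclideanSpace.single j 1)) rfl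
  have hterm : ∀ j : Fin 3, (∂_{EuclideanSpace.single j (1 : ℝ)}
      (Distribution.mapCLM (EuclideanSpace.proj j : E3 →L[ℝ] ℝ) (fieldDistribution μ m) :
        𝓓'((⊤ : TopologicalSpace.Opens E3), ℝ))) φ
      = -∫ y, m y j * fderiv ℝ φ y (EuclideanSpace.single j 1) ∂μ := by
    intro j
    rw [Distribution.lineDerivOp_apply_apply, map_neg, Distribution.mapCLM_apply,
      fieldDistribution_apply hm]
    simp only [testFunction_lineDeriv_apply]
    rw [← ContinuousLinearMap.integral_comp_comm _ (hint j)]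
    simp [mul_comm]
  have hsum : divergence (fieldDistribution μ m) φ = ∑ j : Fin 3,
      (∂_{EuclideanSpace.single j (1 : ℝ)}
      (Distribution.mapCLM (EuclideanSpace.proj j : E3 →L[ℝ] ℝ) (fieldDistribution μ m) :
        𝓓'((⊤ : TopologicalSpace.Opens E3), ℝ))) φ := by
    simp only [divergence, Fin.sum_univ_three]
    rfl
  rw [hsum, Finset.sum_congr rfl fun j _ => hterm j, Finset.sum_neg_distrib, ← integral_finsetSum]
  · simp_rw [← apply_eq_sum]
  · intro j _
    have := (EuclideanSpace.proj j : E3 →L[ℝ] ℝ).integrable_comp (hint j)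
    simpa [mul_comm] using this

/-- Test functions supported off the closed ball have vanishing gradient on the ball. -/
theorem supportedInBall_divergence {R : ℝ} {M : E3 → E3}
    (hM : LocallyIntegrable M (volume.restrict (Metric.ball (0 : E3) R))) :
    SupportedInBall
      (divergence (fieldDistribution (volume.restrict (Metric.ball (0 : E3) R)) M)) R := by
  intro φ hφ
  rw [divergence_fieldDistribution_apply hM, neg_eq_zero]
  refine setIntegral_eq_zero_of_forall_eq_zero fun y hy => ?_
  have h : y ∉ tsupport φ := fun h => hφ h (Metric.ball_subset_closedBall hy)
  rw [fderiv_of_notMem_tsupport (𝕜 := ℝ) h, zero_apply]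

/-- The cutoff does not contribute, being constant near the closed ball. -/
theorem potential_divergence {R : ℝ} (hR : 0 < R) {M : E3 → E3}
    (hM : LocallyIntegrable M (volume.restrict (Metric.ball (0 : E3) R))) {x : E3} (hx : R < ‖x‖) :
    potential (divergence (fieldDistribution (volume.restrict (Metric.ball (0 : E3) R)) M)) hR x hx
      = -∫ y in Metric.ball (0 : E3) R, fderiv ℝ (newtonKernel x) y (M y) := by
  rw [potential, divergence_fieldDistribution_apply hM, neg_inj]
  refine setIntegral_congr_fun Metric.isOpen_ball.measurableSet fun y hy => ?_
  have h1 := (eventually_nhdsSet_iff_forall.1 (cutoff_eventually_one hR hx)) y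
    (Metric.ball_subset_closedBall hy)
  have : (truncKernel x (cutoff hR hx) (cutoff_eventually_zero hR hx) : E3 → ℝ)
      =ᶠ[𝓝 y] newtonKernel x := by
    filter_upwards [h1] with z hz
    change newtonKernel x z * cutoff hR hx z = _
    rw [hz, mul_one]
  simp only [this.fderiv_eq]

/-! ### Divergences of tangential fields as distributions on the sphere -/

theorem hasFDerivAt_norm_of_ne_zero {z : E3} (hz : z ≠ 0) :
    HasFDerivAt (fun z : E3 => ‖z‖) (‖z‖⁻¹ • innerSL ℝ z) z := by
  have h := ((hasStrictFDerivAt_norm_sq z).hasFDerivAt).sqrt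
    (pow_ne_zero 2 (norm_ne_zero_iff.2 hz))
  simp only [norm_nonneg, Real.sqrt_sq] at h
  exact h.congr_fderiv (by ext w; simp; field_simp)

theorem aestronglyMeasurable_fderiv_apply {μ : Measure E3} (u : E3 → ℝ) {m : E3 → E3}
    (hm : AEStronglyMeasurable m μ) : AEStronglyMeasurable (fun y => fderiv ℝ u y (m y)) μ :=
  (isBoundedBilinearMap_apply (𝕜 := ℝ) (E := E3) (F := ℝ)).continuous.comp_aestronglyMeasurable
    ((measurable_fderiv ℝ u).aestronglyMeasurable.prodMk hm)

theorem ae_sphereMeasure_mem_sphere {r : ℝ} (hr : 0 ≤ r) :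
    ∀ᵐ y ∂sphereMeasure r, y ∈ Metric.sphere (0 : E3) r := by
  have hmeas : Measurable fun y : Metric.sphere (0 : E3) 1 => r • (y : E3) := by fun_prop
  refine Measure.ae_smul_measure ?_ _
  refine (ae_map_iff hmeas.aemeasurable
    (p := fun y => y ∈ Metric.sphere (0 : E3) r) Metric.isClosed_sphere.measurableSet).2 ?_
  refine ae_of_all _ fun y => ?_
  simp [norm_smul, abs_of_nonneg hr]

instance (r : ℝ) : IsFiniteMeasure (sphereMeasure r) := by
  unfold sphereMeasure
  exact Measure.smul_finite _ ENNReal.ofReal_ne_top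

theorem radialExt_restrict_eventuallyEq {R : ℝ} (hR : 0 < R) (F : E3 → ℝ)
    (hF : ∀ y ∈ Metric.sphere (0 : E3) R, ContDiffAt ℝ ∞ F y) {y : E3} (hy : y ≠ 0) :
    radialExt R (SmoothSphere.restrict hR F hF) =ᶠ[𝓝 y] fun x => F ((R / ‖x‖) • x) := by
  filter_upwards [isOpen_ne.mem_nhds hy] with x hx
  exact radialExt_apply hR _ hx

/-- The retraction `x ↦ R x / |x|` onto the sphere has derivative the identity in tangential
directions. -/
theorem exists_hasFDerivAt_radial_retraction {R : ℝ} (hR : 0 < R) {y v : E3} (hy : ‖y‖ = R)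
    (hv : inner ℝ y v = 0) :
    ∃ L : E3 →L[ℝ] E3, HasFDerivAt (fun x : E3 => (R / ‖x‖) • x) L y ∧ L v = v := by
  have hy0 : y ≠ 0 := norm_ne_zero_iff.1 (by rw [hy]; exact hR.ne')
  have hn := hasFDerivAt_norm_of_ne_zero hy0
  have hq : HasFDerivAt (fun x : E3 => R / ‖x‖)
      (-(R / ‖y‖ ^ 2) • (‖y‖⁻¹ • innerSL ℝ y)) y := by
    have := ((hasDerivAt_inv (norm_ne_zero_iff.2 hy0)).comp_hasFDerivAt y hn).const_mul R
    simp only [div_eq_mul_inv]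
    exact this.congr_fderiv (by ext w; simp; ring)
  have h : HasFDerivAt (fun x : E3 => (R / ‖x‖) • x) _ y := hq.smul (hasFDerivAt_id y)
  exact ⟨_, h, by simp [hv, hy, hR.ne']⟩

theorem fderiv_radialExt_restrict_apply {R : ℝ} (hR : 0 < R) (F : E3 → ℝ)
    (hF : ∀ y ∈ Metric.sphere (0 : E3) R, ContDiffAt ℝ ∞ F y) {y v : E3} (hy : ‖y‖ = R)
    (hv : inner ℝ y v = 0) :
    fderiv ℝ (radialExt R (SmoothSphere.restrict hR F hF)) y v = fderiv ℝ F y v := by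
  have hy0 : y ≠ 0 := norm_ne_zero_iff.1 (by rw [hy]; exact hR.ne')
  rw [(radialExt_restrict_eventuallyEq hR F hF hy0).fderiv_eq]
  obtain ⟨L, h1, h2⟩ := exists_hasFDerivAt_radial_retraction hR hy hv
  have hfix : (R / ‖y‖) • y = y := by rw [hy, div_self hR.ne', one_smul]
  have hFy : HasFDerivAt F (fderiv ℝ F y) ((fun x : E3 => (R / ‖x‖) • x) y) := by
    simp only [hfix]
    exact ((hF y (by simpa using hy)).differentiableAt (by simp)).hasFDerivAt
  rw [show (fun x => F ((R / ‖x‖) • x)) = F ∘ fun x => (R / ‖x‖) • x from rfl,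
    (HasFDerivAt.comp (f := fun x : E3 => (R / ‖x‖) • x) y hFy h1).fderiv,
    ContinuousLinearMap.comp_apply, h2]

theorem SmoothSphere.integrable_fderiv_apply {R : ℝ} (hR : 0 < R) {m : E3 → E3}
    (hm : Integrable m (sphereMeasure R)) (f : SmoothSphere R) :
    Integrable (fun y => fderiv ℝ (radialExt R f) y (m y)) (sphereMeasure R) := by
  have hc : ContinuousOn (fderiv ℝ (radialExt R f)) {0}ᶜ :=
    f.2.continuousOn_fderiv_of_isOpen isOpen_compl_singleton (by simp)
  have hsub : Metric.sphere (0 : E3) R ⊆ {0}ᶜ := by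
    rintro y hy rfl
    simp [hR.ne] at hy
  obtain ⟨C, hC⟩ := (isCompact_sphere (0 : E3) R).exists_bound_of_continuousOn (hc.mono hsub)
  refine (hm.norm.const_mul C).mono' ?_ ?_
  · exact aestronglyMeasurable_fderiv_apply _ hm.aestronglyMeasurable
  · filter_upwards [ae_sphereMeasure_mem_sphere hR.le] with y hy
    exact (ContinuousLinearMap.le_opNorm _ _).trans
      (mul_le_mul_of_nonneg_right (hC y hy) (norm_nonneg _))

/-- The surface divergence of `m`, as the distribution `f ↦ -∫ m · ∇f dω_R` on the sphere, where
`∇f` is the gradient of the radial extension of `f`. This gradient is tangential, so only the tangential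
part of `m` matters. -/
def sphereDivergence {R : ℝ} (hR : 0 < R) (m : E3 → E3) (hm : Integrable m (sphereMeasure R)) :
    SphereDistribution R where
  toLinearMap :=
    { toFun := fun f => -∫ y, fderiv ℝ (radialExt R f) y (m y) ∂sphereMeasure R
      map_add' := by
        intro f g
        rw [← neg_add, ← integral_add (SmoothSphere.integrable_fderiv_apply hR hm f)
          (SmoothSphere.integrable_fderiv_apply hR hm g), neg_inj]
        refine integral_congr_ae ?_
        filter_upwards [ae_sphereMeasure_mem_sphere hR.le] with y hy
        have hy0 : y ∈ ({0}ᶜ : Set E3) := by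
          rintro rfl
          simp [hR.ne] at hy
        have hd : ∀ f : SmoothSphere R, DifferentiableAt ℝ (radialExt R f) y := fun f =>
          (f.2.contDiffAt (isOpen_compl_singleton.mem_nhds hy0)).differentiableAt (by simp)
        simp only [Submodule.coe_add, radialExt_add]
        rw [fderiv_add (hd f) (hd g), add_apply]
      map_smul' := by
        intro c f
        simp only [Submodule.coe_smul, radialExt_smul, RingHom.id_apply, smul_eq_mul]
        rw [mul_neg, ← integral_const_mul, neg_inj]
        refine integral_congr_ae ?_
        filter_upwards [ae_sphereMeasure_mem_sphere hR.le] with y hy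
        rw [fderiv_const_smul_field]
        simp }
  continuous' := by
    refine ⟨1, ∫ y, ‖m y‖ ∂sphereMeasure R, fun f A hA => ?_⟩
    simp only [LinearMap.coe_mk, AddHom.coe_mk, abs_neg]
    rw [← integral_mul_const, ← Real.norm_eq_abs]
    refine norm_integral_le_of_norm_le (hm.norm.mul_const A) ?_
    filter_upwards [ae_sphereMeasure_mem_sphere hR.le] with y hy
    have h := hA 1 le_rfl y hy
    rw [norm_iteratedFDeriv_one] at h
    rw [mul_comm]
    exact (ContinuousLinearMap.le_opNorm _ _).trans
      (mul_le_mul_of_nonneg_right h (norm_nonneg _))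

/-- For a tangential field, the pairing with a function on the sphere can be computed from any
smooth extension of that function. -/
theorem sphereDivergence_restrict {R : ℝ} (hR : 0 < R) {m : E3 → E3}
    (hm : Integrable m (sphereMeasure R)) (htan : ∀ y, inner ℝ y (m y) = 0) (F : E3 → ℝ)
    (hF : ∀ y ∈ Metric.sphere (0 : E3) R, ContDiffAt ℝ ∞ F y) :
    (sphereDivergence hR m hm).toLinearMap (SmoothSphere.restrict hR F hF)
      = -∫ y, fderiv ℝ F y (m y) ∂sphereMeasure R := by
  change -∫ y, fderiv ℝ (radialExt R (SmoothSphere.restrict hR F hF)) y (m y) ∂sphereMeasure R = _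
  rw [neg_inj]
  refine integral_congr_ae ?_
  filter_upwards [ae_sphereMeasure_mem_sphere hR.le] with y hy
  exact fderiv_radialExt_restrict_apply hR F hF (by simpa using hy) (htan y)

/-! ### Integrals over concentric spheres -/

/-- Differentiation under the integral sign over a compact space; continuity of the derivative
provides the domination. -/
theorem hasDerivAt_integral_of_continuousOn {K : Type*} [TopologicalSpace K] [CompactSpace K]
    [MeasurableSpace K] [OpensMeasurableSpace K] {μ : Measure K} [IsFiniteMeasure μ]
    {F F' : ℝ → K → ℝ} {s : Set ℝ} (hs : IsOpen s)
    (hF : ContinuousOn (fun p : ℝ × K => F p.1 p.2) (s ×ˢ univ))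
    (hF' : ContinuousOn (fun p : ℝ × K => F' p.1 p.2) (s ×ˢ univ))
    (hd : ∀ t ∈ s, ∀ x, HasDerivAt (fun t => F t x) (F' t x) t) {t : ℝ} (ht : t ∈ s) :
    HasDerivAt (fun t => ∫ x, F t x ∂μ) (∫ x, F' t x ∂μ) t := by
  obtain ⟨ε, hε, hεs⟩ := Metric.nhds_basis_closedBall.mem_iff.1 (hs.mem_nhds ht)
  have hsec : ∀ {G : ℝ → K → ℝ}, ContinuousOn (fun p : ℝ × K => G p.1 p.2) (s ×ˢ univ) →
      ∀ τ ∈ s, Continuous (G τ) := by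
    intro G hG τ hτ
    rw [← continuousOn_univ]
    exact hG.comp (f := fun x : K => (τ, x)) (by fun_prop) fun x hx => ⟨hτ, hx⟩
  have hcomp : IsCompact (Metric.closedBall t ε ×ˢ (univ : Set K)) :=
    (isCompact_closedBall t ε).prod isCompact_univ
  obtain ⟨C, hC⟩ := hcomp.exists_bound_of_continuousOn (hF'.mono (prod_mono hεs subset_rfl))
  have hb : Metric.closedBall t ε ∈ 𝓝 t := Metric.closedBall_mem_nhds t hε
  refine (hasDerivAt_integral_of_dominated_loc_of_deriv_le (bound := fun _ => C) hb ?_ ?_ ?_ ?_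
    (integrable_const C) ?_).2
  · filter_upwards [hs.mem_nhds ht] with τ hτ
    exact (hsec hF τ hτ).aestronglyMeasurable_of_compactSpace
  · exact (hsec hF t ht).integrable_of_hasCompactSupport (HasCompactSupport.of_compactSpace _)
  · exact (hsec hF' t ht).aestronglyMeasurable_of_compactSpace
  · exact ae_of_all _ fun x τ hτ => hC (τ, x) ⟨hτ, mem_univ _⟩
  · exact ae_of_all _ fun x τ hτ => hd τ (hεs hτ) x

/-- The integral `∫ f(rσ) dσ` of `f` over the sphere of radius `r`, with respect to the surface
measure of the unit sphere: the factor `r²` is left out, so that differentiation in `r` acts on `f` only. -/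
def sphereIntegral (f : E3 → ℝ) (r : ℝ) : ℝ :=
  ∫ σ : Metric.sphere (0 : E3) 1, f (r • (σ : E3)) ∂(volume : Measure E3).toSphere

open Pointwise in
/-- The surface measure of the unit sphere is invariant under linear isometries. -/
theorem integral_toSphere_comp_isometry (g : E3 ≃ₗᵢ[ℝ] E3) (f : E3 → ℝ) :
    ∫ σ : Metric.sphere (0 : E3) 1, f (g σ) ∂(volume : Measure E3).toSphere
      = ∫ σ : Metric.sphere (0 : E3) 1, f σ ∂(volume : Measure E3).toSphere := by
  let gs : Metric.sphere (0 : E3) 1 ≃ₜ Metric.sphere (0 : E3) 1 :=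
    g.toHomeomorph.subtype fun x => by simp
  have hmp : MeasurePreserving gs (volume : Measure E3).toSphere
      (volume : Measure E3).toSphere := by
    refine ⟨gs.measurable, Measure.ext fun s hs => ?_⟩
    rw [Measure.map_apply gs.measurable hs, Measure.toSphere_apply' _ (gs.measurable hs),
      Measure.toSphere_apply' _ hs]
    congr 1
    have himg : Ioo (0 : ℝ) 1 • ((↑) '' s : Set E3)
        = g '' (Ioo (0 : ℝ) 1 • ((↑) '' (gs ⁻¹' s) : Set E3)) := by
      ext x
      simp only [Set.mem_smul, mem_image, mem_preimage]
      constructor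
      · rintro ⟨c, hc, _, ⟨y, hy, rfl⟩, rfl⟩
        refine ⟨c • (gs.symm y : E3), ⟨c, hc, _, ⟨gs.symm y, by simpa, rfl⟩, rfl⟩, ?_⟩
        have : g (gs.symm y : E3) = y := congrArg Subtype.val (gs.apply_symm_apply y)
        rw [map_smul, this]
      · rintro ⟨_, ⟨c, hc, _, ⟨y, hy, rfl⟩, rfl⟩, rfl⟩
        exact ⟨c, hc, _, ⟨gs y, hy, rfl⟩, (map_smul g c (y : E3)).symm⟩
    rw [himg, ← g.measurePreserving.measure_preimage_emb
      g.toHomeomorph.measurableEmbedding (g '' _), g.injective.preimage_image]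
  exact hmp.integral_comp gs.measurableEmbedding (fun σ => f σ)

theorem smul_sphere_mem_ball {ρ r : ℝ} (hr : |r| < ρ) (σ : Metric.sphere (0 : E3) 1) :
    r • (σ : E3) ∈ Metric.ball (0 : E3) ρ := by
  simpa [norm_smul] using hr

/-- The integral over a sphere of the derivative of a function along the vector field generated by
a one-parameter group of rotations vanishes. -/
theorem sphereIntegral_fderiv_skew {ρ : ℝ} {f : E3 → ℝ}
    (hf : ContDiffOn ℝ 1 f (Metric.ball 0 ρ)) {A : E3 →L[ℝ] E3}
    (hA : A ∈ skewAdjoint (E3 →L[ℝ] E3)) {r : ℝ} (hr : |r| < ρ) :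
    sphereIntegral (fun x => fderiv ℝ f x (A x)) r = 0 := by
  let _ : NormedAlgebra ℚ (E3 →L[ℝ] E3) := NormedAlgebra.restrictScalars ℚ ℝ _
  have hU : ∀ t : ℝ, NormedSpace.exp (t • A) ∈ unitary (E3 →L[ℝ] E3) := fun t =>
    NormedSpace.exp_mem_unitary_of_mem_skewAdjoint (skewAdjoint.smul_mem t hA)
  let g : ℝ → E3 ≃ₗᵢ[ℝ] E3 := fun t => Unitary.linearIsometryEquiv ⟨_, hU t⟩
  have hg : ∀ (t : ℝ) (x : E3), g t x = NormedSpace.exp (t • A) x := fun t x => rfl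
  have hmem : ∀ (t : ℝ) (σ : Metric.sphere (0 : E3) 1),
      NormedSpace.exp (t • A) (r • (σ : E3)) ∈ Metric.ball (0 : E3) ρ := by
    intro t σ
    rw [← hg, mem_ball_zero_iff, LinearIsometryEquiv.norm_map, ← mem_ball_zero_iff]
    exact smul_sphere_mem_ball hr σ
  have hexp : ∀ t : ℝ, HasDerivAt (fun t : ℝ => NormedSpace.exp (t • A))
      (A * NormedSpace.exp (t • A)) t := fun t => hasDerivAt_exp_smul_const' A t
  have hexpc : Continuous fun t : ℝ => NormedSpace.exp (t • A) :=
    continuous_iff_continuousAt.2 fun t => (hexp t).continuousAt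
  have hpath : Continuous fun p : ℝ × Metric.sphere (0 : E3) 1 =>
      NormedSpace.exp (p.1 • A) (r • (p.2 : E3)) :=
    (hexpc.comp continuous_fst).clm_apply (by fun_prop)
  -- By invariance `t ↦ ∫ f(exp(tA) rσ) dσ` is constant; its derivative at `0` is the given integral.
  have key := hasDerivAt_integral_of_continuousOn (μ := (volume : Measure E3).toSphere)
    (F := fun (t : ℝ) (σ : Metric.sphere (0 : E3) 1) =>
      f (NormedSpace.exp (t • A) (r • (σ : E3))))
    (F' := fun (t : ℝ) (σ : Metric.sphere (0 : E3) 1) =>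
      fderiv ℝ f (NormedSpace.exp (t • A) (r • (σ : E3)))
        (A (NormedSpace.exp (t • A) (r • (σ : E3))))) isOpen_univ
    (hf.continuousOn.comp hpath.continuousOn fun p _ => hmem p.1 p.2)
    (((hf.continuousOn_fderiv_of_isOpen Metric.isOpen_ball le_rfl).comp hpath.continuousOn
      fun p _ => hmem p.1 p.2).clm_apply (A.continuous.comp hpath).continuousOn)
    (fun t _ σ => by
      have h1 : HasFDerivAt f _ (NormedSpace.exp (t • A) (r • (σ : E3))) :=
        ((hf.contDiffAt (Metric.isOpen_ball.mem_nhds (hmem t σ))).differentiableAt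
          one_ne_zero).hasFDerivAt
      have h2 := (hexp t).clm_apply (hasDerivAt_const t (r • (σ : E3)))
      exact (h1.comp_hasDerivAt t h2).congr_deriv (by simp)) (mem_univ 0)
  have hconst : ∀ t : ℝ, ∫ σ : Metric.sphere (0 : E3) 1,
      f (NormedSpace.exp (t • A) (r • (σ : E3))) ∂(volume : Measure E3).toSphere
      = ∫ σ : Metric.sphere (0 : E3) 1, f (r • (σ : E3)) ∂(volume : Measure E3).toSphere := by
    intro t
    rw [← integral_toSphere_comp_isometry (g t) fun x => f (r • x)]
    simp [hg]
  simp only [hconst] at key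
  have h0 := key.unique (hasDerivAt_const _ _)
  have hA0 : NormedSpace.exp ((0 : ℝ) • A) = 1 :=
    (congrArg NormedSpace.exp (zero_smul ℝ A)).trans NormedSpace.exp_zero
  simpa only [hA0, one_apply_eq_self, sphereIntegral] using h0

theorem hasDerivAt_sphereIntegral {ρ : ℝ} {f : E3 → ℝ}
    (hf : ContDiffOn ℝ 1 f (Metric.ball 0 ρ)) {r : ℝ} (hr : |r| < ρ) :
    HasDerivAt (sphereIntegral f)
      (∫ σ : Metric.sphere (0 : E3) 1, fderiv ℝ f (r • (σ : E3)) σ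
        ∂(volume : Measure E3).toSphere) r := by
  have hmem : MapsTo (fun p : ℝ × Metric.sphere (0 : E3) 1 => p.1 • (p.2 : E3))
      (Metric.ball 0 ρ ×ˢ univ) (Metric.ball (0 : E3) ρ) := fun p hp =>
    smul_sphere_mem_ball (by simpa using hp.1) p.2
  have hpath : Continuous fun p : ℝ × Metric.sphere (0 : E3) 1 => p.1 • (p.2 : E3) := by fun_prop
  refine hasDerivAt_integral_of_continuousOn (s := Metric.ball 0 ρ) Metric.isOpen_ball
    (F := fun r (σ : Metric.sphere (0 : E3) 1) => f (r • (σ : E3)))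
    (F' := fun r (σ : Metric.sphere (0 : E3) 1) => fderiv ℝ f (r • (σ : E3)) σ)
    (hf.continuousOn.comp hpath.continuousOn hmem)
    (((hf.continuousOn_fderiv_of_isOpen Metric.isOpen_ball le_rfl).comp hpath.continuousOn
      hmem).clm_apply (by fun_prop)) (fun t ht σ => ?_) (by simpa using hr)
  have h1 : HasFDerivAt f _ (t • (σ : E3)) :=
    ((hf.contDiffAt (Metric.isOpen_ball.mem_nhds
      (smul_sphere_mem_ball (by simpa using ht) σ))).differentiableAt one_ne_zero).hasFDerivAt
  have h2 : HasDerivAt (fun t : ℝ => t • (σ : E3)) (σ : E3) t := by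
    simpa using (hasDerivAt_id t).smul_const (σ : E3)
  exact h1.comp_hasDerivAt t h2

theorem continuous_comp_smul_sphere {ρ : ℝ} {f : E3 → ℝ}
    (hf : ContinuousOn f (Metric.ball 0 ρ)) {r : ℝ} (hr : |r| < ρ) :
    Continuous fun σ : Metric.sphere (0 : E3) 1 => f (r • (σ : E3)) := by
  rw [← continuousOn_univ]
  exact hf.comp (by fun_prop) fun σ _ => smul_sphere_mem_ball hr σ

theorem integrable_comp_smul_sphere {ρ : ℝ} {f : E3 → ℝ}
    (hf : ContinuousOn f (Metric.ball 0 ρ)) {r : ℝ} (hr : |r| < ρ) :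
    Integrable (fun σ : Metric.sphere (0 : E3) 1 => f (r • (σ : E3)))
      (volume : Measure E3).toSphere :=
  (continuous_comp_smul_sphere hf hr).integrable_of_hasCompactSupport
    (HasCompactSupport.of_compactSpace _)

/-- The derivative of `r ↦ r ∫ f(rσ) dσ` is the spherical integral of `f + x · ∇f`. -/
theorem hasDerivAt_mul_sphereIntegral {ρ : ℝ} {f : E3 → ℝ}
    (hf : ContDiffOn ℝ 1 f (Metric.ball 0 ρ)) {r : ℝ} (hr : |r| < ρ) :
    HasDerivAt (fun r => r * sphereIntegral f r)
      (sphereIntegral (fun x => f x + fderiv ℝ f x x) r) r := by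
  refine ((hasDerivAt_id' r).fun_mul (hasDerivAt_sphereIntegral hf hr)).congr_deriv ?_
  have hd : ContinuousOn (fun x => fderiv ℝ f x x) (Metric.ball 0 ρ) :=
    (hf.continuousOn_fderiv_of_isOpen Metric.isOpen_ball le_rfl).clm_apply continuousOn_id
  simp only [sphereIntegral]
  rw [integral_add (integrable_comp_smul_sphere hf.continuousOn hr)
    (integrable_comp_smul_sphere hd hr), one_mul, ← integral_const_mul]
  simp

theorem continuousOn_sphereIntegral {ρ : ℝ} {f : E3 → ℝ}
    (hf : ContinuousOn f (Metric.ball 0 ρ)) :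
    ContinuousOn (sphereIntegral f) (Metric.ball 0 ρ) := by
  have hpath : Continuous fun p : ℝ × Metric.sphere (0 : E3) 1 => p.1 • (p.2 : E3) := by fun_prop
  have h := continuousOn_integral_of_compact_support (μ := (volume : Measure E3).toSphere)
    (f := fun r (σ : Metric.sphere (0 : E3) 1) => f (r • (σ : E3))) (s := Metric.ball 0 ρ)
    (k := univ) isCompact_univ (hf.comp hpath.continuousOn fun p hp =>
      smul_sphere_mem_ball (by simpa using hp.1) p.2) (by simp)
  exact h

theorem integral_sphereMeasure {r : ℝ} (hr : 0 < r) (f : E3 → ℝ) :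
    ∫ y, f y ∂sphereMeasure r = r ^ 2 * sphereIntegral f r := by
  have hc : Topology.IsClosedEmbedding fun y : Metric.sphere (0 : E3) 1 => r • (y : E3) :=
    Continuous.isClosedEmbedding (by fun_prop) fun y z h => by
      exact Subtype.ext (smul_right_injective E3 hr.ne' h)
  rw [sphereMeasure, integral_smul_measure, hc.measurableEmbedding.integral_map,
    ENNReal.toReal_ofReal (by positivity)]
  rfl

/-- Integration in polar coordinates. -/
theorem integral_ball_eq_integral_sphereIntegral {R : ℝ} (hR : 0 < R) {f : E3 → ℝ}
    (hf : IntegrableOn f (Metric.ball 0 R)) :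
    ∫ x in Metric.ball (0 : E3) R, f x = ∫ r in 0..R, r ^ 2 * sphereIntegral f r := by
  have hmp := (volume : Measure E3).measurePreserving_homeomorphUnitSphereProd
  have hdim : Module.finrank ℝ E3 - 1 = 2 := by simp
  rw [hdim] at hmp
  set g : E3 → ℝ := (Metric.ball (0 : E3) R).indicator f with hg
  have hgi : Integrable g := (integrable_indicator_iff measurableSet_ball).2 hf
  let G : Metric.sphere (0 : E3) 1 × Ioi (0 : ℝ) → ℝ := fun p => g (p.2.1 • (p.1 : E3))
  have hG : ∀ x : ({0}ᶜ : Set E3), G (homeomorphUnitSphereProd E3 x) = g x := by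
    intro x
    have : ‖(x : E3)‖ ≠ 0 := norm_ne_zero_iff.2 x.2
    simp [G, smul_smul, this]
  have hcomap : Integrable (fun x : ({0}ᶜ : Set E3) => g x) ((volume : Measure E3).comap (↑)) := by
    have := hgi.integrableOn (s := ({0}ᶜ : Set E3))
    rwa [integrableOn_iff_comap_subtypeVal (measurableSet_singleton _).compl] at this
  have hGi : Integrable G ((volume : Measure E3).toSphere.prod (Measure.volumeIoiPow 2)) := by
    rw [← hmp.integrable_comp_emb (Homeomorph.measurableEmbedding _)]
    exact hcomap.congr (ae_of_all _ fun x => (hG x).symm)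
  calc ∫ x in Metric.ball (0 : E3) R, f x = ∫ x, g x := (integral_indicator measurableSet_ball).symm
    _ = ∫ x : ({0}ᶜ : Set E3), g x ∂((volume : Measure E3).comap (↑)) := by
      rw [integral_subtype_comap (measurableSet_singleton _).compl, restrict_compl_singleton]
    _ = ∫ p, G p ∂((volume : Measure E3).toSphere.prod (Measure.volumeIoiPow 2)) := by
      rw [← hmp.integral_comp (Homeomorph.measurableEmbedding _)]
      exact integral_congr_ae (ae_of_all _ fun x => (hG x).symm)
    _ = ∫ r : Ioi (0 : ℝ), sphereIntegral g r ∂(Measure.volumeIoiPow 2) :=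
      integral_prod_symm _ hGi
    _ = ∫ r in Ioi (0 : ℝ), r ^ 2 * sphereIntegral g r := by
      simp only [Measure.volumeIoiPow, ENNReal.ofReal]
      rw [integral_withDensity_eq_integral_smul
        ((measurable_subtype_coe.pow_const _).real_toNNReal),
        integral_subtype_comap measurableSet_Ioi fun a ↦ Real.toNNReal (a ^ 2) • sphereIntegral g a]
      refine setIntegral_congr_fun measurableSet_Ioi fun x hx => ?_
      simp only [NNReal.smul_def, smul_eq_mul]
      rw [Real.coe_toNNReal _ (by positivity)]
    _ = ∫ r in Ioi (0 : ℝ), (Iio R).indicator (fun r => r ^ 2 * sphereIntegral f r) r := by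
      refine setIntegral_congr_fun measurableSet_Ioi fun r (hr : 0 < r) => ?_
      by_cases h : r < R
      · have : ∀ σ : Metric.sphere (0 : E3) 1, g (r • (σ : E3)) = f (r • (σ : E3)) := fun σ =>
          indicator_of_mem (smul_sphere_mem_ball (by rwa [abs_of_pos hr]) σ) f
        simp [h, sphereIntegral, this]
      · have : ∀ σ : Metric.sphere (0 : E3) 1, g (r • (σ : E3)) = 0 := fun σ =>
          indicator_of_notMem (by simpa [norm_smul, abs_of_pos hr] using h) f
        simp [h, sphereIntegral, this]
    _ = ∫ r in 0..R, r ^ 2 * sphereIntegral f r := by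
      rw [setIntegral_indicator measurableSet_Iio, Ioi_inter_Iio,
        intervalIntegral.integral_of_le hR.le, integral_Ioc_eq_integral_Ioo]

/-! ### Infinitesimal rotations -/

/-- The cross product `x ↦ eₖ × x`, the generator of the rotations about the `k`-th axis. -/
def rotGen (k : Fin 3) : E3 →L[ℝ] E3 :=
  (EuclideanSpace.proj (k + 1) : E3 →L[ℝ] ℝ).smulRight (EuclideanSpace.single (k + 2) 1)
    - (EuclideanSpace.proj (k + 2) : E3 →L[ℝ] ℝ).smulRight (EuclideanSpace.single (k + 1) 1)

theorem rotGen_apply (k : Fin 3) (x : E3) :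
    rotGen k x = x (k + 1) • EuclideanSpace.single (k + 2) (1 : ℝ)
      - x (k + 2) • EuclideanSpace.single (k + 1) (1 : ℝ) := rfl

theorem inner_rotGen_left (k : Fin 3) (x y : E3) :
    inner ℝ (rotGen k x) y = -inner ℝ x (rotGen k y) := by
  simp [rotGen_apply, inner_sub_left, inner_sub_right, inner_smul_left, inner_smul_right,
    EuclideanSpace.inner_single_left, EuclideanSpace.inner_single_right]
  ring

theorem rotGen_mem_skewAdjoint (k : Fin 3) : rotGen k ∈ skewAdjoint (E3 →L[ℝ] E3) := by
  rw [skewAdjoint.mem_iff, ContinuousLinearMap.star_eq_adjoint, eq_comm,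
    ContinuousLinearMap.eq_adjoint_iff]
  intro x y
  rw [neg_apply, inner_neg_left, inner_rotGen_left, neg_neg]

theorem inner_rotGen_self (k : Fin 3) (x : E3) : inner ℝ x (rotGen k x) = 0 := by
  have h := inner_rotGen_left k x x
  rw [real_inner_comm] at h
  linarith

theorem norm_sq_eq_three (x : E3) : ‖x‖ ^ 2 = x 0 ^ 2 + x 1 ^ 2 + x 2 ^ 2 := by
  rw [EuclideanSpace.norm_sq_eq, Fin.sum_univ_three]
  simp

/-- Lagrange's identity. -/
theorem sum_apply_rotGen_sq (L : E3 →L[ℝ] ℝ) (x : E3) :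
    ∑ k, L (rotGen k x) ^ 2 = ‖x‖ ^ 2 * ‖L‖ ^ 2 - L x ^ 2 := by
  have hL : ‖L‖ ^ 2 = L (EuclideanSpace.single 0 1) ^ 2 + L (EuclideanSpace.single 1 1) ^ 2
      + L (EuclideanSpace.single 2 1) ^ 2 := by
    obtain ⟨w, rfl⟩ := (InnerProductSpace.toDual ℝ E3).surjective L
    rw [LinearIsometryEquiv.norm_map, norm_sq_eq_three]
    simp [EuclideanSpace.inner_single_right]
  rw [hL, norm_sq_eq_three, apply_eq_sum_three L x]
  simp [Fin.sum_univ_three, rotGen_apply]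
  ring

/-- The sum of the second derivatives along the three rotation fields at `x` is
`|x|² Δ - (x · ∇)² - x · ∇`; here `B` and `L` stand for the second and the first derivative. -/
theorem sum_rotGen_second (B : E3 →L[ℝ] E3 →L[ℝ] ℝ) (hB : ∀ v w, B v w = B w v)
    (L : E3 →L[ℝ] ℝ) (x : E3) :
    ∑ k, (B (rotGen k x) (rotGen k x) + L (rotGen k (rotGen k x)))
      = ‖x‖ ^ 2 * ∑ i : Fin 3, B (EuclideanSpace.single i 1) (EuclideanSpace.single i 1)
        - B x x - 2 * L x := by
  have hBx : B x x = x 0 * B (EuclideanSpace.single 0 1) x + x 1 * B (EuclideanSpace.single 1 1) x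
      + x 2 * B (EuclideanSpace.single 2 1) x := by
    simp_rw [hB _ x]
    exact apply_eq_sum_three (B x) x
  rw [norm_sq_eq_three, hBx, apply_eq_sum_three (B (EuclideanSpace.single 0 1)) x,
    apply_eq_sum_three (B (EuclideanSpace.single 1 1)) x,
    apply_eq_sum_three (B (EuclideanSpace.single 2 1)) x,
    apply_eq_sum_three L x]
  simp [Fin.sum_univ_three, rotGen_apply]
  rw [hB (EuclideanSpace.single 1 1) (EuclideanSpace.single 0 1),
    hB (EuclideanSpace.single 2 1) (EuclideanSpace.single 0 1),
    hB (EuclideanSpace.single 2 1) (EuclideanSpace.single 1 1)]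
  ring

/-- The derivative `x ↦ Du(x)(Ax)` of `u` along the linear vector field `A`. -/
def derivAlong (A : E3 →L[ℝ] E3) (u : E3 → ℝ) (x : E3) : ℝ := fderiv ℝ u x (A x)

theorem contDiffOn_derivAlong {U : Set E3} (hU : IsOpen U) {u : E3 → ℝ}
    (hu : ContDiffOn ℝ ∞ u U) (A : E3 →L[ℝ] E3) : ContDiffOn ℝ ∞ (derivAlong A u) U :=
  (hu.fderiv_of_isOpen hU le_rfl).clm_apply A.contDiff.contDiffOn

theorem fderiv_derivAlong_apply {U : Set E3} (hU : IsOpen U) {u : E3 → ℝ}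
    (hu : ContDiffOn ℝ ∞ u U) (A : E3 →L[ℝ] E3) {x : E3} (hx : x ∈ U) (v : E3) :
    fderiv ℝ (derivAlong A u) x v = fderiv ℝ (fderiv ℝ u) x v (A x) + fderiv ℝ u x (A v) := by
  have h1 : DifferentiableAt ℝ (fderiv ℝ u) x :=
    ((hu.fderiv_of_isOpen hU (m := ∞) le_rfl).contDiffAt (hU.mem_nhds hx)).differentiableAt
      (by simp)
  change fderiv ℝ (fun x => fderiv ℝ u x (A x)) x v = _
  rw [fderiv_clm_apply h1 A.differentiableAt]
  simp [add_comm]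

open Laplacian in
theorem laplacian_eq_sum_fderiv (u : E3 → ℝ) (x : E3) :
    Δ u x = ∑ i : Fin 3, fderiv ℝ (fderiv ℝ u) x (EuclideanSpace.single i 1)
      (EuclideanSpace.single i 1) := by
  rw [InnerProductSpace.laplacian_eq_iteratedFDeriv_orthonormalBasis u
    (EuclideanSpace.basisFun (Fin 3) ℝ)]
  simp [iteratedFDeriv_two_apply]

/-- The density `∑ₖ (Lₖ u)² - (x · ∇u)²`, the difference of the squared tangential and normal
derivatives, times `|x|²`; here `Lₖ` is the derivative along the field `rotGen k`. -/
def rellichDensity (u : E3 → ℝ) (x : E3) : ℝ :=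
  ∑ k, derivAlong (rotGen k) u x ^ 2 - derivAlong (.id ℝ E3) u x ^ 2

theorem contDiffOn_rellichDensity {U : Set E3} (hU : IsOpen U) {u : E3 → ℝ}
    (hu : ContDiffOn ℝ ∞ u U) : ContDiffOn ℝ ∞ (rellichDensity u) U :=
  (ContDiffOn.sum fun k _ => (contDiffOn_derivAlong hU hu (rotGen k)).pow 2).sub
    ((contDiffOn_derivAlong hU hu (.id ℝ E3)).pow 2)

open Laplacian in
/-- A pointwise form of Rellich's identity for harmonic functions: up to derivatives along rotation
fields, which integrate to zero over spheres, `(1 + x · ∇)` of the Rellich density is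
`|x|² |∇u|²`. -/
theorem rellichDensity_add_fderiv {U : Set E3} (hU : IsOpen U) {u : E3 → ℝ}
    (hu : ContDiffOn ℝ ∞ u U) {x : E3} (hx : x ∈ U) (hharm : Δ u x = 0) :
    rellichDensity u x + fderiv ℝ (rellichDensity u) x x
      = ‖x‖ ^ 2 * ‖fderiv ℝ u x‖ ^ 2 + 2 * ∑ k, derivAlong (rotGen k)
        (fun y => derivAlong (rotGen k) u y * derivAlong (.id ℝ E3) u y) x := by
  have hd : ∀ A, HasFDerivAt (derivAlong A u) (fderiv ℝ (derivAlong A u) x) x := fun A =>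
    (((contDiffOn_derivAlong hU hu A).contDiffAt (hU.mem_nhds hx)).differentiableAt
      (by simp)).hasFDerivAt
  have hsymm : ∀ v w, fderiv ℝ (fderiv ℝ u) x v w = fderiv ℝ (fderiv ℝ u) x w v := fun v w =>
    ((hu.contDiffAt (hU.mem_nhds hx)).isSymmSndFDerivAt
      (by rw [minSmoothness_of_isRCLikeNormedField]; exact mod_cast ENat.LEInfty.out)) v w
  have hg : fderiv ℝ (rellichDensity u) x x = ∑ k, 2 * (derivAlong (rotGen k) u x
      * fderiv ℝ (derivAlong (rotGen k) u) x x)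
      - 2 * (derivAlong (.id ℝ E3) u x * fderiv ℝ (derivAlong (.id ℝ E3) u) x x) := by
    have h : HasFDerivAt (rellichDensity u) _ x :=
      (HasFDerivAt.fun_sum (u := Finset.univ) fun k _ => (hd (rotGen k)).pow 2).sub
        ((hd (.id ℝ E3)).pow 2)
    rw [h.fderiv]
    simp [mul_assoc]
  have hprod : ∀ k, derivAlong (rotGen k)
      (fun y => derivAlong (rotGen k) u y * derivAlong (.id ℝ E3) u y) x
      = derivAlong (rotGen k) u x * fderiv ℝ (derivAlong (.id ℝ E3) u) x (rotGen k x)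
        + derivAlong (.id ℝ E3) u x * fderiv ℝ (derivAlong (rotGen k) u) x (rotGen k x) := by
    intro k
    rw [derivAlong, ((hd (rotGen k)).fun_mul (hd (.id ℝ E3))).fderiv]
    simp
  have hlap := sum_rotGen_second (fderiv ℝ (fderiv ℝ u) x) hsymm (fderiv ℝ u x) x
  rw [← laplacian_eq_sum_fderiv, hharm] at hlap
  have hlag := sum_apply_rotGen_sq (fderiv ℝ u x) x
  rw [hg]
  simp_rw [hprod, fderiv_derivAlong_apply hU hu _ hx]
  simp only [rellichDensity, derivAlong, ContinuousLinearMap.id_apply, Fin.sum_univ_three] at *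
  -- `hlap` says `∑ Lₖ² u = -(E² u + E u)`; this sum enters the identity with the factor `2 E u`.
  rw [hsymm (rotGen 0 x) x, hsymm (rotGen 1 x) x, hsymm (rotGen 2 x) x]
  linear_combination hlag - 2 * fderiv ℝ u x x * hlap

/-! ### The Newton kernel is harmonic -/

open Laplacian in
theorem laplacian_newtonKernel {x y : E3} (h : y ≠ x) : Δ (newtonKernel x) y = 0 := by
  obtain ⟨c, hc⟩ : ∃ c : ℝ, c = -(1 / (4 * Real.pi)) := ⟨_, rfl⟩
  have hz : ∀ {y}, y ≠ x → x - y ≠ 0 := fun h => sub_ne_zero.2 h.symm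
  have hnorm : ∀ {y}, y ≠ x → HasFDerivAt (fun y : E3 => ‖x - y‖)
      (-(‖x - y‖⁻¹ • innerSL ℝ (x - y))) y := by
    intro y hy
    exact ((hasFDerivAt_norm_of_ne_zero (hz hy)).comp y ((hasFDerivAt_id y).const_sub x)).congr_fderiv
      (by ext w; simp)
  have h1 : ∀ {y}, y ≠ x → HasFDerivAt (newtonKernel x)
      ((c * (‖x - y‖ ^ 3)⁻¹) • innerSL ℝ (x - y)) y := by
    intro y hy
    have hn : ‖x - y‖ ≠ 0 := norm_ne_zero_iff.2 (hz hy)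
    have := ((hasDerivAt_inv hn).comp_hasFDerivAt y (hnorm hy)).const_mul c
    have hN : newtonKernel x = fun y => c * ‖x - y‖⁻¹ := by
      funext y
      rw [newtonKernel, hc, one_div ‖x - y‖]
    rw [hN]
    exact this.congr_fderiv (by ext w; simp; field_simp)
  have hev : fderiv ℝ (newtonKernel x) =ᶠ[𝓝 y]
      fun y => (c * (‖x - y‖ ^ 3)⁻¹) • innerSL ℝ (x - y) := by
    filter_upwards [isOpen_ne.mem_nhds h] with z hzx
    exact (h1 hzx).fderiv
  have hn : ‖x - y‖ ≠ 0 := norm_ne_zero_iff.2 (hz h)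
  have h2 := (((hasDerivAt_inv (pow_ne_zero 3 hn)).comp_hasFDerivAt y ((hnorm h).pow 3)).const_mul
    c).smul ((innerSL ℝ : E3 →L[ℝ] E3 →L[ℝ] ℝ).hasFDerivAt.comp y ((hasFDerivAt_id y).const_sub x))
  rw [laplacian_eq_sum_fderiv, hev.fderiv_eq]
  have h3 : HasFDerivAt (fun y => (c * (‖x - y‖ ^ 3)⁻¹) • innerSL ℝ (x - y)) _ y := h2
  rw [h3.fderiv]
  have hs := norm_sq_eq_three (x - y)
  have hin : ∀ a b : E3, (innerSL ℝ : E3 →L[ℝ] E3 →L[ℝ] ℝ) a b = inner ℝ a b := fun _ _ => rfl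
  simp [Fin.sum_univ_three, hin, EuclideanSpace.inner_single_right] at hs ⊢
  field_simp
  linear_combination (-3 * c) * hs

/-! ### Rellich's inequality -/

theorem continuousOn_norm_fderiv_sq {U : Set E3} (hU : IsOpen U) {u : E3 → ℝ}
    (hu : ContDiffOn ℝ ∞ u U) : ContinuousOn (fun x => ‖fderiv ℝ u x‖ ^ 2) U :=
  (hu.continuousOn_fderiv_of_isOpen hU (by simp)).norm.pow 2

theorem integrableOn_ball_of_continuousOn {R ρ : ℝ} (hRρ : R < ρ) {f : E3 → ℝ}
    (hf : ContinuousOn f (Metric.ball 0 ρ)) : IntegrableOn f (Metric.ball 0 R) :=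
  ((hf.mono (Metric.closedBall_subset_ball hRρ)).integrableOn_compact
    (isCompact_closedBall 0 R)).mono_set Metric.ball_subset_closedBall

open Laplacian in
/-- The pointwise Rellich identity integrated over a sphere, where the rotational derivatives drop
out. -/
theorem sphereIntegral_rellich {ρ : ℝ} {u : E3 → ℝ} (hu : ContDiffOn ℝ ∞ u (Metric.ball 0 ρ))
    (hharm : ∀ x ∈ Metric.ball (0 : E3) ρ, Δ u x = 0) {r : ℝ} (hr : |r| < ρ) :
    sphereIntegral (fun x => rellichDensity u x + fderiv ℝ (rellichDensity u) x x) r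
      = r ^ 2 * sphereIntegral (fun x => ‖fderiv ℝ u x‖ ^ 2) r := by
  have ho : IsOpen (Metric.ball (0 : E3) ρ) := Metric.isOpen_ball
  have hw : ∀ k, ContDiffOn ℝ ∞
      (fun y => derivAlong (rotGen k) u y * derivAlong (.id ℝ E3) u y) (Metric.ball 0 ρ) :=
    fun k => (contDiffOn_derivAlong ho hu _).mul (contDiffOn_derivAlong ho hu _)
  have hrot : ∀ k, ∫ σ : Metric.sphere (0 : E3) 1, derivAlong (rotGen k)
      (fun y => derivAlong (rotGen k) u y * derivAlong (.id ℝ E3) u y) (r • (σ : E3))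
      ∂(volume : Measure E3).toSphere = 0 := fun k =>
    sphereIntegral_fderiv_skew ((hw k).of_le (by simp)) (rotGen_mem_skewAdjoint k) hr
  have hpt : ∀ σ : Metric.sphere (0 : E3) 1, _ := fun σ =>
    rellichDensity_add_fderiv ho hu (smul_sphere_mem_ball hr σ)
      (hharm _ (smul_sphere_mem_ball hr σ))
  have hrint : ∀ k, Integrable (fun σ : Metric.sphere (0 : E3) 1 => derivAlong (rotGen k)
      (fun y => derivAlong (rotGen k) u y * derivAlong (.id ℝ E3) u y) (r • (σ : E3)))
      (volume : Measure E3).toSphere := fun k =>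
    integrable_comp_smul_sphere (contDiffOn_derivAlong ho (hw k) _).continuousOn hr
  simp only [sphereIntegral]
  simp_rw [hpt]
  rw [integral_add, integral_const_mul, integral_finsetSum _ fun k _ => hrint k,
    Finset.sum_eq_zero fun k _ => hrot k, mul_zero, add_zero, ← integral_const_mul]
  · simp [norm_smul]
  · simp only [norm_smul, norm_eq_of_mem_sphere]
    exact (integrable_comp_smul_sphere (continuousOn_norm_fderiv_sq ho hu) hr).const_mul _
  · exact (integrable_finsetSum _ fun k _ => hrint k).const_mul 2

open Laplacian in
/-- Rellich's identity on a ball: the Dirichlet integral of a harmonic function is the boundary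
integral of the difference of the squared tangential and normal derivatives. -/
theorem integral_norm_fderiv_sq_eq {R ρ : ℝ} (hR : 0 < R) (hRρ : R < ρ) {u : E3 → ℝ}
    (hu : ContDiffOn ℝ ∞ u (Metric.ball 0 ρ))
    (hharm : ∀ x ∈ Metric.ball (0 : E3) ρ, Δ u x = 0) :
    ∫ x in Metric.ball (0 : E3) R, ‖fderiv ℝ u x‖ ^ 2
      = R * sphereIntegral (rellichDensity u) R := by
  have ho : IsOpen (Metric.ball (0 : E3) ρ) := Metric.isOpen_ball
  have hc := continuousOn_norm_fderiv_sq ho hu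
  have hr : ∀ r ∈ uIcc 0 R, |r| < ρ := by
    intro r hr
    rw [uIcc_of_le hR.le] at hr
    rw [abs_of_nonneg hr.1]
    exact hr.2.trans_lt hRρ
  rw [integral_ball_eq_integral_sphereIntegral hR (integrableOn_ball_of_continuousOn hRρ hc)]
  rw [intervalIntegral.integral_eq_sub_of_hasDerivAt
    (f := fun r => r * sphereIntegral (rellichDensity u) r)]
  · simp
  · intro r hr'
    rw [← sphereIntegral_rellich hu hharm (hr r hr')]
    exact hasDerivAt_mul_sphereIntegral ((contDiffOn_rellichDensity ho hu).of_le (by simp))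
      (hr r hr')
  · refine ContinuousOn.intervalIntegrable ((continuousOn_pow 2).mul
      ((continuousOn_sphereIntegral hc).mono fun r hr' => ?_))
    simpa using hr r hr'

/-- The vector `y × ∇u(y)` of the three rotational derivatives of `u`. -/
def rotGradient (u : E3 → ℝ) (y : E3) : E3 :=
  WithLp.toLp 2 fun k => derivAlong (rotGen k) u y

theorem norm_rotGradient_sq (u : E3 → ℝ) (y : E3) :
    ‖rotGradient u y‖ ^ 2 = ∑ k, derivAlong (rotGen k) u y ^ 2 := by
  simp [rotGradient, EuclideanSpace.norm_sq_eq]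

open Laplacian in
/-- The Dirichlet integral of a harmonic function over a ball is bounded by the square integral of
its tangential gradient over the boundary sphere. -/
theorem integral_norm_fderiv_sq_le {R ρ : ℝ} (hR : 0 < R) (hRρ : R < ρ) {u : E3 → ℝ}
    (hu : ContDiffOn ℝ ∞ u (Metric.ball 0 ρ))
    (hharm : ∀ x ∈ Metric.ball (0 : E3) ρ, Δ u x = 0) :
    ∫ x in Metric.ball (0 : E3) R, ‖fderiv ℝ u x‖ ^ 2
      ≤ R⁻¹ * ∫ y, ‖rotGradient u y‖ ^ 2 ∂sphereMeasure R := by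
  have ho : IsOpen (Metric.ball (0 : E3) ρ) := Metric.isOpen_ball
  have hRρ' : |R| < ρ := by rwa [abs_of_pos hR]
  have h : sphereIntegral (rellichDensity u) R
      ≤ sphereIntegral (fun y => ‖rotGradient u y‖ ^ 2) R := by
    refine integral_mono
      (integrable_comp_smul_sphere (contDiffOn_rellichDensity ho hu).continuousOn hRρ')
      (integrable_comp_smul_sphere (ρ := ρ) (f := fun y => ‖rotGradient u y‖ ^ 2) ?_ hRρ')
      fun σ => ?_
    · simp_rw [norm_rotGradient_sq]
      exact continuousOn_finsetSum _ fun k _ =>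
        ((contDiffOn_derivAlong ho hu (rotGen k)).continuousOn.pow 2)
    · simp only [rellichDensity, norm_rotGradient_sq]
      exact sub_le_self _ (sq_nonneg _)
  rw [integral_norm_fderiv_sq_eq hR hRρ hu hharm, integral_sphereMeasure hR]
  calc R * sphereIntegral (rellichDensity u) R
      ≤ R * sphereIntegral (fun y => ‖rotGradient u y‖ ^ 2) R := by gcongr
    _ = _ := by field_simp

/-! ### Linear forms dominated by a map into a Hilbert space -/

/-- A linear form on `V` that is dominated by the norm of a linear map `T` into a Hilbert space is
represented, through `T`, by a vector of the Hilbert space. -/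
theorem exists_inner_representation {V H : Type*} [AddCommGroup V] [Module ℝ V]
    [NormedAddCommGroup H] [InnerProductSpace ℝ H] [CompleteSpace H] (T : V →ₗ[ℝ] H)
    (l : V →ₗ[ℝ] ℝ) (C : ℝ) (hl : ∀ v, |l v| ≤ C * ‖T v‖) :
    ∃ w : H, ∀ v, l v = inner ℝ w (T v) := by
  -- A linear section `s` of `T` transports `l` to a bounded form on the range of `T`.
  obtain ⟨s, hs⟩ := T.rangeRestrict.exists_rightInverse_of_surjective T.range_rangeRestrict
  have hTs : ∀ y, T (s y) = y := fun y => congrArg Subtype.val (LinearMap.congr_fun hs y)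
  let f : LinearMap.range T →L[ℝ] ℝ := (l ∘ₗ s).mkContinuous C fun y => by
    simpa [hTs] using hl (s y)
  obtain ⟨g, hg, -⟩ := exists_extension_norm_eq (LinearMap.range T) f
  refine ⟨(InnerProductSpace.toDual ℝ H).symm g, fun v => ?_⟩
  rw [InnerProductSpace.toDual_symm_apply]
  have h1 : g (T v) = l (s (T.rangeRestrict v)) := hg (T.rangeRestrict v)
  have h2 : l (v - s (T.rangeRestrict v)) = 0 := by
    have h := hl (v - s (T.rangeRestrict v))
    rw [map_sub T, hTs, show (T.rangeRestrict v : H) = T v from rfl, sub_self, norm_zero,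
      mul_zero] at h
    exact abs_nonpos_iff.1 h
  rw [h1, ← sub_eq_zero, ← map_sub, h2]

/-! ### Harmonic functions near the closed ball -/

open Laplacian in
/-- The functions that are smooth and harmonic on some open ball about `0` of radius larger than
`R`, which may depend on the function; their values outside that ball are arbitrary. -/
def harmonicNearBall (R : ℝ) : Submodule ℝ (E3 → ℝ) where
  carrier := {u | ∃ ρ, R < ρ ∧ ContDiffOn ℝ ∞ u (Metric.ball 0 ρ) ∧
    ∀ x ∈ Metric.ball (0 : E3) ρ, Δ u x = 0}
  zero_mem' := ⟨R + 1, by linarith, contDiffOn_const, fun x _ => by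
    change Δ (fun _ : E3 => (0 : ℝ)) x = 0
    simp⟩
  add_mem' := by
    rintro u v ⟨ρ, hρ, hu, hu'⟩ ⟨ρ', hρ', hv, hv'⟩
    have h1 : Metric.ball (0 : E3) (min ρ ρ') ⊆ Metric.ball 0 ρ :=
      Metric.ball_subset_ball (min_le_left _ _)
    have h2 : Metric.ball (0 : E3) (min ρ ρ') ⊆ Metric.ball 0 ρ' :=
      Metric.ball_subset_ball (min_le_right _ _)
    have h2le : (2 : WithTop ℕ∞) ≤ ∞ := mod_cast ENat.LEInfty.out
    refine ⟨min ρ ρ', lt_min hρ hρ', (hu.mono h1).add (hv.mono h2), fun x hx => ?_⟩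
    rw [ContDiffAt.laplacian_add
      ((hu.contDiffAt (Metric.isOpen_ball.mem_nhds (h1 hx))).of_le h2le)
      ((hv.contDiffAt (Metric.isOpen_ball.mem_nhds (h2 hx))).of_le h2le),
      hu' x (h1 hx), hv' x (h2 hx), add_zero]
  smul_mem' := by
    rintro c u ⟨ρ, hρ, hu, hu'⟩
    have h2le : (2 : WithTop ℕ∞) ≤ ∞ := mod_cast ENat.LEInfty.out
    refine ⟨ρ, hρ, hu.const_smul c, fun x hx => ?_⟩
    rw [InnerProductSpace.laplacian_smul c
      ((hu.contDiffAt (Metric.isOpen_ball.mem_nhds hx)).of_le h2le),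
      hu' x hx, smul_zero]

theorem newtonKernel_mem_harmonicNearBall {R : ℝ} {x : E3} (hx : R < ‖x‖) :
    newtonKernel x ∈ harmonicNearBall R := by
  have hne : ∀ y ∈ Metric.ball (0 : E3) ‖x‖, y ≠ x := by
    rintro y hy rfl
    simp at hy
  exact ⟨‖x‖, hx, fun y hy => (contDiffAt_newtonKernel (hne y hy)).contDiffWithinAt,
    fun y hy => laplacian_newtonKernel (hne y hy)⟩

instance isFiniteMeasure_restrict_ball (R : ℝ) (x : E3) :
    IsFiniteMeasure ((volume : Measure E3).restrict (Metric.ball x R)) :=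
  ⟨by simpa using measure_ball_lt_top (μ := (volume : Measure E3)) (x := x) (r := R)⟩

theorem harmonicNearBall.differentiableAt {R : ℝ} {u : E3 → ℝ}
    (hu : u ∈ harmonicNearBall R) {y : E3}
    (hy : y ∈ Metric.closedBall (0 : E3) R) : DifferentiableAt ℝ u y := by
  obtain ⟨ρ, hρ, hu, -⟩ := hu
  exact (hu.contDiffAt (Metric.isOpen_ball.mem_nhds
    (Metric.closedBall_subset_ball hρ hy))).differentiableAt (by simp)

theorem harmonicNearBall.exists_norm_fderiv_le {R : ℝ} {u : E3 → ℝ}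
    (hu : u ∈ harmonicNearBall R) :
    ∃ C, ∀ y ∈ Metric.closedBall (0 : E3) R, ‖fderiv ℝ u y‖ ≤ C := by
  obtain ⟨ρ, hρ, hu, -⟩ := hu
  exact (isCompact_closedBall (0 : E3) R).exists_bound_of_continuousOn
    ((hu.continuousOn_fderiv_of_isOpen Metric.isOpen_ball (by simp)).mono
      (Metric.closedBall_subset_ball hρ))

theorem harmonicNearBall.integrable_fderiv_apply {R : ℝ} {u : E3 → ℝ}
    (hu : u ∈ harmonicNearBall R)
    {M : E3 → E3} (hM : IntegrableOn M (Metric.ball 0 R)) :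
    IntegrableOn (fun y => fderiv ℝ u y (M y)) (Metric.ball 0 R) := by
  obtain ⟨C, hC⟩ := exists_norm_fderiv_le hu
  refine (hM.norm.const_mul C).mono' (aestronglyMeasurable_fderiv_apply u hM.1) ?_
  filter_upwards [ae_restrict_mem measurableSet_ball] with y hy
  exact (ContinuousLinearMap.le_opNorm _ _).trans
    (mul_le_mul_of_nonneg_right (hC y (Metric.ball_subset_closedBall hy)) (norm_nonneg _))

theorem harmonicNearBall.memLp_rotGradient {R : ℝ} (hR : 0 < R) {u : E3 → ℝ}
    (hu : u ∈ harmonicNearBall R) : MemLp (rotGradient u) 2 (sphereMeasure R) := by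
  obtain ⟨C, hC⟩ := exists_norm_fderiv_le hu
  refine MemLp.of_eval_piLp fun k => ?_
  refine MemLp.of_bound (aestronglyMeasurable_fderiv_apply u
    (rotGen k).continuous.aestronglyMeasurable) (C * (‖rotGen k‖ * R)) ?_
  filter_upwards [ae_sphereMeasure_mem_sphere hR.le] with y hy
  have h1 := hC y (Metric.sphere_subset_closedBall hy)
  have h2 : ‖rotGen k y‖ ≤ ‖rotGen k‖ * R := by
    simpa [mem_sphere_zero_iff_norm.1 hy] using (rotGen k).le_opNorm y
  exact (ContinuousLinearMap.le_opNorm _ _).trans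
    (mul_le_mul h1 h2 (norm_nonneg _) ((norm_nonneg _).trans h1))

theorem harmonicNearBall.rotGradient_add_ae {R : ℝ} (hR : 0 < R) {u v : E3 → ℝ}
    (hu : u ∈ harmonicNearBall R) (hv : v ∈ harmonicNearBall R) :
    rotGradient (u + v) =ᵐ[sphereMeasure R] rotGradient u + rotGradient v := by
  filter_upwards [ae_sphereMeasure_mem_sphere hR.le] with y hy
  have hy' := Metric.sphere_subset_closedBall hy
  ext k
  simp [rotGradient, derivAlong, fderiv_add (differentiableAt hu hy') (differentiableAt hv hy')]

theorem rotGradient_smul (c : ℝ) (u : E3 → ℝ) : rotGradient (c • u) = c • rotGradient u := by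
  funext y
  ext k
  simp [rotGradient, derivAlong, fderiv_const_smul_field]

/-! ### The tangential field on the sphere -/

/-- The map `u ↦ (y × ∇u)|_{S_R}` from harmonic functions to `L²(S_R, ℝ³)`. -/
def rotGradientLp {R : ℝ} (hR : 0 < R) : harmonicNearBall R →ₗ[ℝ] Lp E3 2 (sphereMeasure R) where
  toFun u := (harmonicNearBall.memLp_rotGradient hR u.2).toLp
  map_add' u v := by
    rw [← MemLp.toLp_add, MemLp.toLp_eq_toLp_iff]
    exact harmonicNearBall.rotGradient_add_ae hR u.2 v.2
  map_smul' c u := by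
    rw [RingHom.id_apply, ← MemLp.toLp_const_smul, MemLp.toLp_eq_toLp_iff]
    exact .of_eq (rotGradient_smul c u)

/-- The functional `u ↦ ∫_{B_R} M · ∇u` on harmonic functions. -/
def gradientPairing {R : ℝ} {M : E3 → E3} (hM : IntegrableOn M (Metric.ball 0 R)) :
    harmonicNearBall R →ₗ[ℝ] ℝ where
  toFun u := ∫ y in Metric.ball (0 : E3) R, fderiv ℝ u y (M y)
  map_add' u v := by
    rw [← integral_add (harmonicNearBall.integrable_fderiv_apply u.2 hM)
      (harmonicNearBall.integrable_fderiv_apply v.2 hM)]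
    refine setIntegral_congr_fun measurableSet_ball fun y hy => ?_
    have hy' := Metric.ball_subset_closedBall hy
    simp [fderiv_add (harmonicNearBall.differentiableAt u.2 hy')
      (harmonicNearBall.differentiableAt v.2 hy')]
  map_smul' c u := by
    rw [RingHom.id_apply, smul_eq_mul, ← integral_const_mul]
    simp [fderiv_const_smul_field]

theorem norm_toLp_sq {α F : Type*} [MeasurableSpace α] {μ : Measure α} [NormedAddCommGroup F]
    [InnerProductSpace ℝ F] {f : α → F} (hf : MemLp f 2 μ) :
    ‖hf.toLp‖ ^ 2 = ∫ y, ‖f y‖ ^ 2 ∂μ := by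
  rw [← real_inner_self_eq_norm_sq, L2.inner_def]
  refine integral_congr_ae ?_
  filter_upwards [hf.coeFn_toLp] with y hy
  rw [hy, real_inner_self_eq_norm_sq]

/-- The Cauchy-Schwarz inequality on the ball combined with the bound of the Dirichlet integral by
the tangential gradient. -/
theorem abs_gradientPairing_le {R : ℝ} (hR : 0 < R) {M : E3 → E3}
    (hM : MemLp M 2 (volume.restrict (Metric.ball (0 : E3) R)))
    (hM1 : IntegrableOn M (Metric.ball 0 R)) (u : harmonicNearBall R) :
    |gradientPairing hM1 u| ≤ ‖hM.toLp‖ * Real.sqrt R⁻¹ * ‖rotGradientLp hR u‖ := by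
  obtain ⟨C, hC⟩ := harmonicNearBall.exists_norm_fderiv_le u.2
  have hD : MemLp (fun y => fderiv ℝ (u : E3 → ℝ) y) 2
      (volume.restrict (Metric.ball (0 : E3) R)) := by
    refine MemLp.of_bound (measurable_fderiv ℝ _).aestronglyMeasurable C ?_
    filter_upwards [ae_restrict_mem measurableSet_ball] with y hy
    exact hC y (Metric.ball_subset_closedBall hy)
  have hdir : Real.sqrt (∫ y in Metric.ball (0 : E3) R, ‖fderiv ℝ (u : E3 → ℝ) y‖ ^ 2)
      ≤ Real.sqrt R⁻¹ * ‖rotGradientLp hR u‖ := by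
    obtain ⟨ρ, hρ, hu, hharm⟩ := u.2
    refine Real.sqrt_le_iff.2 ⟨by positivity, ?_⟩
    rw [mul_pow, Real.sq_sqrt (by positivity)]
    change _ ≤ R⁻¹ * ‖(harmonicNearBall.memLp_rotGradient hR u.2).toLp‖ ^ 2
    rw [norm_toLp_sq]
    exact integral_norm_fderiv_sq_le hR hρ hu hharm
  have hMn : Real.sqrt (∫ y in Metric.ball (0 : E3) R, ‖M y‖ ^ 2) = ‖hM.toLp‖ := by
    rw [← norm_toLp_sq hM, Real.sqrt_sq (norm_nonneg _)]
  have hCS := integral_mul_le_Lp_mul_Lq_of_nonneg (μ := volume.restrict (Metric.ball (0 : E3) R))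
    (f := fun y => ‖M y‖) (g := fun y => ‖fderiv ℝ (u : E3 → ℝ) y‖) Real.HolderConjugate.two_two
    (ae_of_all _ fun y => norm_nonneg _) (ae_of_all _ fun y => norm_nonneg _)
    (by simpa using hM.norm) (by simpa using hD.norm)
  simp only [Real.rpow_two, ← Real.sqrt_eq_rpow] at hCS
  calc |gradientPairing hM1 u|
      ≤ ∫ y in Metric.ball (0 : E3) R, ‖M y‖ * ‖fderiv ℝ (u : E3 → ℝ) y‖ := by
        refine norm_integral_le_of_norm_le (f := fun y => fderiv ℝ (u : E3 → ℝ) y (M y))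
          (hM.norm.integrable_mul hD.norm) (ae_of_all _ fun y => ?_)
        rw [mul_comm]
        exact ContinuousLinearMap.le_opNorm _ _
    _ ≤ _ := hCS
    _ ≤ ‖hM.toLp‖ * (Real.sqrt R⁻¹ * ‖rotGradientLp hR u‖) := by
        rw [hMn]
        gcongr
    _ = _ := by ring

/-- There is a tangential square integrable field on the sphere whose pairing with the gradients of
harmonic functions coincides with that of `M`. -/
theorem exists_tangential_field {R : ℝ} (hR : 0 < R) {M : E3 → E3}
    (hM : MemLp M 2 (volume.restrict (Metric.ball (0 : E3) R))) :
    ∃ m : E3 → E3, MemLp m 2 (sphereMeasure R) ∧ (∀ y, inner ℝ y (m y) = 0) ∧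
      ∀ u ∈ harmonicNearBall R, ∫ y, fderiv ℝ u y (m y) ∂sphereMeasure R
        = ∫ y in Metric.ball (0 : E3) R, fderiv ℝ u y (M y) := by
  have hM1 : IntegrableOn M (Metric.ball 0 R) := hM.integrable one_le_two
  obtain ⟨w, hw⟩ := exists_inner_representation (rotGradientLp hR) (gradientPairing hM1) _
    (abs_gradientPairing_le hR hM hM1)
  -- The field is `w(y) × y`, since `w · (y × ∇u) = (w × y) · ∇u`.
  refine ⟨fun y => ∑ k, w y k • rotGen k y, ?_, fun y => ?_, fun u hu => ?_⟩
  · refine memLp_finsetSum _ fun k _ => ?_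
    have hwk : MemLp (fun y => w y k) 2 (sphereMeasure R) :=
      (EuclideanSpace.proj k : E3 →L[ℝ] ℝ).comp_memLp' (Lp.memLp w)
    refine (hwk.norm.const_mul (‖rotGen k‖ * R)).of_le (hwk.1.smul
      (rotGen k).continuous.aestronglyMeasurable) ?_
    filter_upwards [ae_sphereMeasure_mem_sphere hR.le] with y hy
    have h2 : ‖rotGen k y‖ ≤ ‖rotGen k‖ * R := by
      simpa [mem_sphere_zero_iff_norm.1 hy] using (rotGen k).le_opNorm y
    rw [norm_smul, mul_comm]
    refine (mul_le_mul_of_nonneg_right h2 (norm_nonneg _)).trans (le_abs_self _ |>.trans ?_)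
    simp
  · simp [inner_sum, inner_smul_right, inner_rotGen_self]
  · have h := hw ⟨u, hu⟩
    rw [L2.inner_def] at h
    refine (h.trans (integral_congr_ae ?_)).symm
    filter_upwards [(harmonicNearBall.memLp_rotGradient hR hu).coeFn_toLp] with y hy
    change inner ℝ (w y) ((harmonicNearBall.memLp_rotGradient hR hu).toLp _ y) = _
    rw [hy]
    simp [rotGradient, derivAlong, PiLp.inner_apply, mul_comm]

end Balayage

end

open Balayage
theorem lemma3p2 (R : ℝ) (hR : 0 < R) (M : E3 → E3)
    (hM : MemLp M 2 (volume.restrict (Metric.ball (0 : E3) R)))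
    (hHardy : HardyCondition R M) :
    ∃ m : E3 → E3, MemLp m 2 (sphereMeasure R) ∧
      ∃ Dhat : SphereDistribution R,
        IsBalayage hR
          (divergence (fieldDistribution (volume.restrict (Metric.ball (0 : E3) R)) M)) Dhat ∧
        Dhat.tensorDelta hR = ⇑(divergence (fieldDistribution (sphereMeasure R) m)) := by
  obtain ⟨m, hm, htan, hpair⟩ := exists_tangential_field hR hM
  have hm1 : Integrable m (sphereMeasure R) := hm.integrable one_le_two
  have hMloc : LocallyIntegrable M (volume.restrict (Metric.ball (0 : E3) R)) :=
    (hM.integrable one_le_two).locallyIntegrable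
  refine ⟨m, hm, sphereDivergence hR m hm1, ⟨supportedInBall_divergence hMloc, fun x hx => ?_⟩, ?_⟩
  · rw [SphereDistribution.potential, sphereDivergence_restrict hR hm1 htan,
      potential_divergence hR hMloc hx, hpair _ (newtonKernel_mem_harmonicNearBall hx)]
  · funext φ
    rw [SphereDistribution.tensorDelta, sphereDivergence_restrict hR hm1 htan,
      divergence_fieldDistribution_apply hm1.locallyIntegrable]
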